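/- Let $K/k$ be a separable field extension of degree $6$ and let $\widetilde K/k$ be its Galois closure. Recall that a finite field extension $K/k$ is called Hopf Galois if there exists a finite-dimensional cocommutative $k$-Hopf algebra $H$ such that $K$ is an $H$-module algebra and the $k$-linear map $j\colon K\otimes_k H\to \operatorname{End}_k(K)$, $j(s\otimes h)(t)=s\,(h t)$ for $h\in H$, $s,t\in K$, is bijective. 1. If $[\widetilde K:k]=24$ or $[\widetilde K:k]>36$, then $K/k$ is not Hopf Galois. 2. If $\operatorname{Gal}(\widetilde K/k)\simeq A_4$, then $K/k$ is not Hopf Galois. -/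

import Mathlib

open scoped TensorProduct

universe u v w

/-- An action `μ : H →ₐ[k] End_k(K)` of a `k`-bialgebra `H` on a commutative `k`-algebra `K` makes
`K` an `H`-module algebra if `h · 1 = ε(h) 1` and `h · (x y) = ∑ (h₍₁₎ · x) (h₍₂₎ · y)`, where
`Δ(h) = ∑ h₍₁₎ ⊗ h₍₂₎`. (Here `μ.toLinearMap.flip x` is the map `h ↦ h · x`.) -/
structure IsModuleAlgebraAction {k : Type u} {K : Type v} {H : Type w} [Field k] [Field K]
    [Algebra k K] [Ring H] [Bialgebra k H] (μ : H →ₐ[k] Module.End k K) : Prop where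
  apply_one : ∀ h : H, μ h 1 = algebraMap k K (Coalgebra.counit (R := k) h)
  apply_mul : ∀ (h : H) (x y : K), μ h (x * y) =
    LinearMap.mul' k K
      (TensorProduct.map (μ.toLinearMap.flip x) (μ.toLinearMap.flip y)
        (Coalgebra.comul (R := k) h))

/-- The `k`-linear map `j : K ⊗ H → End_k(K)`, `j (s ⊗ h) (t) = s (h · t)`, attached to an action
`μ` of `H` on `K`. -/
noncomputable def hopfGaloisMap {k : Type u} {K : Type v} {H : Type w} [Field k] [Field K]
    [Algebra k K] [Ring H] [Algebra k H] (μ : H →ₐ[k] Module.End k K) :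
    K ⊗[k] H →ₗ[k] Module.End k K :=
  TensorProduct.lift
    ((LinearMap.mul k (Module.End k K)).compl₁₂ (Algebra.lmul k K).toLinearMap μ.toLinearMap)

theorem hopfGaloisMap_tmul_apply {k : Type u} {K : Type v} {H : Type w} [Field k] [Field K]
    [Algebra k K] [Ring H] [Algebra k H] (μ : H →ₐ[k] Module.End k K) (s : K) (h : H) (t : K) :
    hopfGaloisMap μ (s ⊗ₜ[k] h) t = s * μ h t := by
  simp [hopfGaloisMap]

/-- `K/k` is a Hopf Galois extension: there is a finite-dimensional cocommutative `k`-Hopf algebra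
`H` such that `K` is an `H`-module algebra and `j : K ⊗ H → End_k(K)` is bijective. (A
finite-dimensional `H` has an isomorphic copy, on `Fin n → k`, in the universe of `k`, so it is no
restriction to take `H` there.) -/
def IsHopfGalois (k : Type u) (K : Type v) [Field k] [Field K] [Algebra k K] : Prop :=
  ∃ (H : Type u) (_ : Ring H) (_ : HopfAlgebra k H) (μ : H →ₐ[k] Module.End k K),
    Module.Finite k H ∧ Coalgebra.IsCocomm k H ∧ IsModuleAlgebraAction μ ∧
      Function.Bijective (hopfGaloisMap μ)

/-! This is the Greither–Pareigis argument. Over the normal closure `L`, the group `N` of group-like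
elements of `L ⊗ H` acts simply transitively on the embeddings `K → L`, so `N` has order 6.
`Gal(L/k)` acts on both compatibly and hence embeds in the holomorph `N ⋊ Aut N`
(`galoisHolomorph_injective`). Since `|Aut N|` divides 6, the order of the Galois group divides 36,
which rules out 24 and everything above 36. The order 12 of `A₄` passes this test; there the kernel
of `A₄ → Aut N` is nontrivial, so contains the Klein four-group, yet embeds in `N`, and 4 does not
divide 6. -/

/-! ### Groups of order 6 and their holomorphs. -/

theorem card_mulAut_dvd_of_card_eq_six {N : Type*} [Group N] (hN : Nat.card N = 6) :
    Nat.card (MulAut N) ∣ 6 := by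
  classical
  have : Finite N := Nat.finite_of_card_ne_zero (by omega)
  have : Fintype N := Fintype.ofFinite N
  obtain ⟨b, hb⟩ := exists_prime_orderOf_dvd_card' (G := N) 2 (by omega)
  obtain ⟨a, ha⟩ := exists_prime_orderOf_dvd_card' (G := N) 3 (by omega)
  -- A unique involution is central, which makes `N` cyclic. Otherwise the involutions generate `N`,
  -- and `Aut N` permutes them faithfully.
  by_cases huniq : ∀ c : N, orderOf c = 2 → c = b
  · have hcomm : Commute a b := by
      have h := huniq (a * b * a⁻¹) (by
        rw [← MulAut.conj_apply, MulEquiv.orderOf_eq, hb])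
      exact mul_inv_eq_iff_eq_mul.mp h
    have hab : orderOf (a * b) = Nat.card N := by
      rw [hcomm.orderOf_mul_eq_mul_orderOf_of_coprime (by rw [ha, hb]; decide), ha, hb, hN]
    have : IsCyclic N := isCyclic_of_orderOf_eq_card _ hab
    rw [IsCyclic.card_mulAut, hN]
    decide
  · push Not at huniq
    obtain ⟨c, hc, hcb⟩ := huniq
    let S := {x : N // orderOf x = 2}
    have hgen : Subgroup.closure {x : N | orderOf x = 2} = ⊤ := by
      set T := Subgroup.closure {x : N | orderOf x = 2}
      have hbT : b ∈ T := Subgroup.subset_closure hb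
      have hcT : c ∈ T := Subgroup.subset_closure hc
      have h2 : 2 ∣ Nat.card T := hb ▸ T.orderOf_dvd_natCard hbT
      have h6 : Nat.card T ∣ 6 := hN ▸ T.card_subgroup_dvd_card
      have h3 : 2 < Nat.card T := by
        have hb1 : b ≠ 1 := by rintro rfl; simp at hb
        have hc1 : c ≠ 1 := by rintro rfl; simp at hc
        rw [← Nat.card_eq_of_equiv_fin (Finite.equivFin T), Nat.card_eq_fintype_card,
          Fintype.two_lt_card_iff]
        exact ⟨1, ⟨b, hbT⟩, ⟨c, hcT⟩, fun h => hb1 (congrArg Subtype.val h).symm,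
          fun h => hc1 (congrArg Subtype.val h).symm, fun h => hcb (congrArg Subtype.val h).symm⟩
      apply Subgroup.eq_top_of_card_eq
      rw [hN]
      have := Nat.le_of_dvd (by norm_num) h6
      interval_cases Nat.card T <;> omega
    let f : MulAut N →* Equiv.Perm S :=
      { toFun := fun e => e.toEquiv.subtypeEquiv fun x => by simp
        map_one' := rfl
        map_mul' := fun _ _ => rfl }
    have hf : Function.Injective f := by
      intro e e' h
      have : e.toMonoidHom = e'.toMonoidHom := by
        refine MonoidHom.eq_of_eqOn_dense hgen fun x hx => ?_
        exact congrArg Subtype.val (DFunLike.congr_fun h (⟨x, hx⟩ : S))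
      exact MulEquiv.ext fun x => DFunLike.congr_fun this x
    refine (Subgroup.card_dvd_of_injective f hf).trans ?_
    rw [Nat.card_perm]
    have hS : Nat.card S ≤ 3 := by
      have h1 : Fintype.card {x : N // ¬ orderOf x = 2} + Fintype.card S = 6 := by
        change _ + Fintype.card {x : N // orderOf x = 2} = 6
        rw [Fintype.card_subtype_compl, ← Nat.card_eq_fintype_card (α := N), hN]
        have := Fintype.card_subtype_le (fun x : N => orderOf x = 2)
        rw [← Nat.card_eq_fintype_card (α := N), hN] at this
        omega
      -- `1`, `a`, `a⁻¹` are distinct non-involutions, leaving at most three involutions.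
      have h2 : 2 < Fintype.card {x : N // ¬ orderOf x = 2} := by
        rw [Fintype.two_lt_card_iff]
        refine ⟨⟨1, by simp⟩, ⟨a, by omega⟩, ⟨a⁻¹, by rw [orderOf_inv]; omega⟩, ?_, ?_, ?_⟩
        · intro h
          have h : 1 = a := congrArg Subtype.val h
          rw [← h] at ha
          simp at ha
        · intro h
          have h : 1 = a⁻¹ := congrArg Subtype.val h
          rw [← orderOf_inv, ← h] at ha
          simp at ha
        · intro h
          have h : a = a⁻¹ := congrArg Subtype.val h
          have h : orderOf a ∣ 2 := orderOf_dvd_of_pow_eq_one (by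
            rw [pow_two]; exact mul_eq_one_iff_eq_inv.mpr h)
          rw [ha] at h
          omega
      rw [Nat.card_eq_fintype_card]
      omega
    exact Nat.factorial_dvd_factorial hS

theorem card_dvd_of_injective_holomorph {G N : Type*} [Group G] [Group N] (hN : Nat.card N = 6)
    (f : G →* N ⋊[MonoidHom.id (MulAut N)] MulAut N) (hf : Function.Injective f) :
    Nat.card G ∣ 36 := by
  refine (Subgroup.card_dvd_of_injective f hf).trans ?_
  rw [SemidirectProduct.card, hN]
  exact Nat.mul_dvd_mul_left 6 (card_mulAut_dvd_of_card_eq_six hN)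

/-- Shows that a nontrivial normal subgroup of `A₄` contains the Klein four-group, in a form open to
a finite check. -/
theorem alternatingGroup_four_conj (x : alternatingGroup (Fin 4)) (hx : x ≠ 1)
    (v : alternatingGroup (Fin 4)) (hv : v * v = 1) :
    ∃ a b, (a * x * a⁻¹) * (b * x⁻¹ * b⁻¹) = v := by
  revert x v
  decide +kernel

theorem alternatingGroup_four_not_injective_holomorph {N : Type*} [Group N] (hN : Nat.card N = 6)
    (f : alternatingGroup (Fin 4) →* N ⋊[MonoidHom.id (MulAut N)] MulAut N) :
    ¬ Function.Injective f := by
  intro hf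
  let p := SemidirectProduct.rightHom.comp f
  have hcard : Nat.card p.ker * Nat.card p.range = 12 := by
    rw [← alternatingGroup.card_of_card_eq_four (α := Fin 4) (by simp),
      p.ker.card_eq_card_quotient_mul_card_subgroup, mul_comm,
      Nat.card_congr (QuotientGroup.quotientKerEquivRange p).toEquiv]
  have hrange : Nat.card p.range ∣ 6 :=
    p.range.card_subgroup_dvd_card.trans (card_mulAut_dvd_of_card_eq_six hN)
  have hker : Nat.card p.ker ∣ 6 := by
    let q : p.ker →* N :=
      { toFun := fun g => (f g).left
        map_one' := by simp
        map_mul' := fun g h => by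
          have : (f g).right = 1 := g.2
          simp [this] }
    rw [← hN]
    refine Subgroup.card_dvd_of_injective q fun g h hgh => ?_
    have hg : (f g).right = 1 := g.2
    have hh : (f h).right = 1 := h.2
    exact Subtype.ext (hf (SemidirectProduct.ext hgh (hg.trans hh.symm)))
  have hne : p.ker ≠ ⊥ := by
    intro h
    rw [h, Subgroup.card_bot] at hcard
    have := Nat.le_of_dvd (by norm_num) hrange
    omega
  obtain ⟨x, hx, hx1⟩ := p.ker.bot_or_exists_ne_one.resolve_left hne
  have hle : alternatingGroup.kleinFour (Fin 4) ≤ p.ker := by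
    intro v hv
    have hv2 : v * v = 1 := by
      have := Monoid.pow_exponent_eq_one
        (⟨v, hv⟩ : alternatingGroup.kleinFour (Fin 4))
      rw [alternatingGroup.exponent_kleinFour_of_card_eq_four (by simp), pow_two] at this
      exact congrArg Subtype.val this
    obtain ⟨a, b, rfl⟩ := alternatingGroup_four_conj x hx1 v hv2
    exact mul_mem (p.normal_ker.conj_mem _ hx a) (p.normal_ker.conj_mem _ (inv_mem hx) b)
  have h4 := Subgroup.card_dvd_of_le hle
  rw [alternatingGroup.kleinFour_card_of_card_eq_four (by simp)] at h4
  have := h4.trans hker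
  omega

/-! ### Base change of the Hopf action along an embedding of `K` into `L`. -/

section Twist

variable {k : Type*} {K : Type*} {L : Type*} {H : Type*} [Field k] [Field K] [Field L]
  [Algebra k K] [Algebra k L]

section Ring

variable [Ring H] [Algebra k H] (μ : H →ₐ[k] Module.End k K) (σ : K →ₐ[k] L)

/-- The `L`-linear map `L ⊗ H → Hom_k(K, L)` with `(l ⊗ h) ↦ (t ↦ l σ(h t))`. -/
noncomputable def twistedAction : L ⊗[k] H →ₗ[L] (K →ₗ[k] L) :=
  (σ.toLinearMap.compRight k ∘ₗ μ.toLinearMap).liftBaseChange L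

@[simp]
theorem twistedAction_tmul (l : L) (h : H) (t : K) :
    twistedAction μ σ (l ⊗ₜ h) t = l * σ (μ h t) := by
  simp [twistedAction]

/-- Right multiplication by `h` precomposes with the action of `h`; thus multiplying by `a` on the
left moves the base point from `σ` to `τ`. -/
theorem twistedAction_mul {τ : K →ₐ[k] L} {a : L ⊗[k] H}
    (ha : twistedAction μ σ a = τ.toLinearMap) (b : L ⊗[k] H) :
    twistedAction μ σ (a * b) = twistedAction μ τ b := by
  have key (l : L) (h : H) (t : K) (a : L ⊗[k] H) :
      twistedAction μ σ (a * l ⊗ₜ h) t = l * twistedAction μ σ a (μ h t) := by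
    induction a with
    | zero => simp
    | add x y hx hy => simp only [add_mul, map_add, LinearMap.add_apply, hx, hy, mul_add]
    | tmul l' h' =>
      simp only [Algebra.TensorProduct.tmul_mul_tmul, twistedAction_tmul, map_mul,
        Module.End.mul_apply]
      ring
  induction b with
  | zero => simp
  | add x y hx hy => rw [mul_add, map_add, map_add, hx, hy]
  | tmul l h =>
    ext t
    rw [key, ha]
    simp

theorem twistedAction_map (z : K ⊗[k] H) :
    twistedAction μ σ (Algebra.TensorProduct.map σ (AlgHom.id k H) z) =
      σ.toLinearMap ∘ₗ hopfGaloisMap μ z := by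
  ext t
  induction z with
  | zero => simp
  | add x y hx hy => simp_all
  | tmul s h => simp [hopfGaloisMap_tmul_apply]

theorem twistedAction_comp (g : L →ₐ[k] L) (a : L ⊗[k] H) :
    twistedAction μ (g.comp σ) (Algebra.TensorProduct.map g (AlgHom.id k H) a) =
      g.toLinearMap ∘ₗ twistedAction μ σ a := by
  ext t
  induction a with
  | zero => simp
  | add x y hx hy => simp_all
  | tmul s h => simp

/-- Surjectivity of `j` puts the rank-one maps of a dual basis in the range, and these span over
`L`. Bijectivity of `j` also gives `dim H = dim K`, so dimensions agree. -/
theorem twistedAction_bijective [FiniteDimensional k K] [Module.Finite k H]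
    (hμ : Function.Bijective (hopfGaloisMap μ)) : Function.Bijective (twistedAction μ σ) := by
  let b := Module.finBasis k K
  have hsurj : Function.Surjective (twistedAction μ σ) := by
    rw [← LinearMap.range_eq_top, eq_top_iff]
    rintro f -
    have hf : f = ∑ i, f (b i) • (σ.toLinearMap ∘ₗ (b.coord i).smulRight 1) := by
      refine b.ext fun j => ?_
      simp [Finsupp.single_apply, apply_ite σ]
    rw [hf]
    refine Submodule.sum_mem _ fun i _ => Submodule.smul_mem _ _ ?_
    obtain ⟨z, hz⟩ := hμ.2 ((b.coord i).smulRight 1)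
    exact ⟨_, (twistedAction_map μ σ z).trans (by rw [hz])⟩
  have hH : Module.finrank k H = Module.finrank k K := by
    have h := (LinearEquiv.ofBijective _ hμ).finrank_eq
    rw [Module.finrank_tensorProduct, Module.finrank_linearMap] at h
    exact Nat.eq_of_mul_eq_mul_left Module.finrank_pos h
  have : Module.Finite L (K →ₗ[k] L) := Module.Finite.equiv (b.constr L)
  have hdim : Module.finrank L (L ⊗[k] H) = Module.finrank L (K →ₗ[k] L) := by
    rw [Module.finrank_baseChange, ← (b.constr L (M' := L)).finrank_eq, hH]
    simp
  exact ⟨(LinearMap.injective_iff_surjective_of_finrank_eq_finrank hdim).2 hsurj, hsurj⟩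

end Ring

section Bialgebra

variable [Ring H] [Bialgebra k H] {μ : H →ₐ[k] Module.End k K}

theorem IsModuleAlgebraAction.twistedAction_one (hμ : IsModuleAlgebraAction μ)
    (σ : K →ₐ[k] L) (a : L ⊗[k] H) :
    twistedAction μ σ a 1 = Coalgebra.counit (R := L) a := by
  induction a with
  | zero => simp
  | add x y hx hy => simp_all
  | tmul l h => simp [hμ.apply_one, Algebra.smul_def, mul_comm]

theorem IsModuleAlgebraAction.twistedAction_apply_mul (hμ : IsModuleAlgebraAction μ)
    (σ : K →ₐ[k] L) (a : L ⊗[k] H) (x y : K) :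
    twistedAction μ σ a (x * y) = LinearMap.mul' L L
      (TensorProduct.map (LinearMap.applyₗ' L x ∘ₗ twistedAction μ σ)
        (LinearMap.applyₗ' L y ∘ₗ twistedAction μ σ) (Coalgebra.comul (R := L) a)) := by
  induction a with
  | zero => simp
  | add a b ha hb => simp_all
  | tmul l h =>
    rw [twistedAction_tmul, hμ.apply_mul, TensorProduct.comul_tmul]
    generalize Coalgebra.comul (R := k) h = z
    induction z with
    | zero => simp
    | add a b ha hb => simp_all [mul_add, TensorProduct.tmul_add]
    | tmul h₁ h₂ => simp [mul_left_comm]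

theorem IsModuleAlgebraAction.isGroupLikeElem_iff (hμ : IsModuleAlgebraAction μ)
    (σ : K →ₐ[k] L) [FiniteDimensional k K] [Module.Finite k H]
    (hj : Function.Bijective (hopfGaloisMap μ)) (a : L ⊗[k] H) :
    IsGroupLikeElem L a ↔ ∃ τ : K →ₐ[k] L, twistedAction μ σ a = τ.toLinearMap := by
  constructor
  · intro ha
    refine ⟨AlgHom.ofLinearMap (twistedAction μ σ a) ?_ fun x y => ?_, by ext; rfl⟩
    · rw [hμ.twistedAction_one, ha.counit_eq_one]
    · rw [hμ.twistedAction_apply_mul, ha.comul_eq_tmul_self]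
      simp
  · rintro ⟨τ, hτ⟩
    refine ⟨?_, ?_⟩
    · rw [← hμ.twistedAction_one σ, hτ]
      simp
    -- In the coordinates given by evaluation at the `b i`, both `Δ(a)` and `a ⊗ a` have entries `τ
    -- (b i * b j)`.
    · let b := Module.finBasis k K
      let e : (L ⊗[k] H) ≃ₗ[L] (Fin (Module.finrank k K) → L) :=
        (LinearEquiv.ofBijective _ (twistedAction_bijective μ σ hj)).trans (b.constr L).symm
      let c := Module.Basis.ofEquivFun e
      have hc (a : L ⊗[k] H) (i) : c.repr a i = twistedAction μ σ a (b i) := by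
        simp [c, e, Module.Basis.constr]
      have hcc (z : (L ⊗[k] H) ⊗[L] (L ⊗[k] H)) (i j) : (c.tensorProduct c).repr z (i, j) =
          LinearMap.mul' L L (TensorProduct.map (LinearMap.applyₗ' L (b i) ∘ₗ twistedAction μ σ)
            (LinearMap.applyₗ' L (b j) ∘ₗ twistedAction μ σ) z) := by
        induction z with
        | zero => simp
        | add x y hx hy => simp_all
        | tmul x y => simp [hc, mul_comm]
      refine (c.tensorProduct c).ext_elem fun ⟨i, j⟩ => ?_
      rw [hcc, ← hμ.twistedAction_apply_mul, hcc]
      simp [hτ]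

end Bialgebra

end Twist

/-! ### The regular action of the group-like elements and the Galois action. -/

section Regular

variable {k : Type*} {K : Type*} {L : Type*} {H : Type*} [Field k] [Field K] [Field L]
  [Algebra k K] [Algebra k L] [Ring H] [HopfAlgebra k H] {μ : H →ₐ[k] Module.End k K}
  [FiniteDimensional k K] [Module.Finite k H]

/-- Group-like elements of `L ⊗ H` correspond to `k`-embeddings of `K` into `L`, once one of these
is chosen. -/
noncomputable def groupLikeEquivAlgHom (hμ : IsModuleAlgebraAction μ)
    (hj : Function.Bijective (hopfGaloisMap μ)) (σ : K →ₐ[k] L) :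
    GroupLike L (L ⊗[k] H) ≃ (K →ₐ[k] L) :=
  .ofBijective (fun n => ((hμ.isGroupLikeElem_iff σ hj n.1).1 n.2).choose) <| by
    have hspec (n : GroupLike L (L ⊗[k] H)) :=
      ((hμ.isGroupLikeElem_iff σ hj n.1).1 n.2).choose_spec
    refine ⟨fun m n hmn => ?_, fun τ => ?_⟩
    · refine GroupLike.val_injective ((twistedAction_bijective μ σ hj).1 ?_)
      exact (hspec m).trans ((congrArg AlgHom.toLinearMap hmn).trans (hspec n).symm)
    · obtain ⟨a, ha⟩ := (twistedAction_bijective μ σ hj).2 τ.toLinearMap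
      let n : GroupLike L (L ⊗[k] H) := ⟨a, (hμ.isGroupLikeElem_iff σ hj a).2 ⟨τ, ha⟩⟩
      exact ⟨n, AlgHom.toLinearMap_injective ((hspec n).symm.trans ha)⟩

theorem twistedAction_groupLike (hμ : IsModuleAlgebraAction μ)
    (hj : Function.Bijective (hopfGaloisMap μ)) (σ : K →ₐ[k] L) (n : GroupLike L (L ⊗[k] H)) :
    twistedAction μ σ n.1 = (groupLikeEquivAlgHom hμ hj σ n).toLinearMap :=
  ((hμ.isGroupLikeElem_iff σ hj n.1).1 n.2).choose_spec

/-- Writing `σ·n` for the embedding attached to `n`, this is the right action law `σ·(mn) =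
(σ·m)·n`. -/
theorem groupLikeEquivAlgHom_mul (hμ : IsModuleAlgebraAction μ)
    (hj : Function.Bijective (hopfGaloisMap μ)) (σ : K →ₐ[k] L) (m n : GroupLike L (L ⊗[k] H)) :
    groupLikeEquivAlgHom hμ hj σ (m * n) =
      groupLikeEquivAlgHom hμ hj (groupLikeEquivAlgHom hμ hj σ m) n := by
  apply AlgHom.toLinearMap_injective
  rw [← twistedAction_groupLike, ← twistedAction_groupLike, GroupLike.val_mul,
    twistedAction_mul μ σ (twistedAction_groupLike hμ hj σ m)]

/-- The action of `Gal(L/k)` on the group-like elements of `L ⊗ H`, by endomorphisms. -/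
noncomputable def galoisEndGroupLike (hμ : IsModuleAlgebraAction μ)
    (hj : Function.Bijective (hopfGaloisMap μ)) (σ : K →ₐ[k] L) :
    (L ≃ₐ[k] L) →* Monoid.End (GroupLike L (L ⊗[k] H)) where
  toFun g :=
    { toFun := fun n => ⟨Algebra.TensorProduct.map (g : L →ₐ[k] L) (AlgHom.id k H) n.1,
        -- Being group-like can be tested from any base point; here `g ∘ σ` is the convenient one.
        (hμ.isGroupLikeElem_iff ((g : L →ₐ[k] L).comp σ) hj _).2
          ⟨(g : L →ₐ[k] L).comp (groupLikeEquivAlgHom hμ hj σ n), by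
            rw [twistedAction_comp, twistedAction_groupLike hμ hj]; rfl⟩⟩
      map_one' := GroupLike.val_injective (map_one _)
      map_mul' := fun m n => GroupLike.val_injective (map_mul _ _ _) }
  map_one' := by
    ext n
    exact DFunLike.congr_fun (Algebra.TensorProduct.map_id (R := k) (S := k)) n.1
  map_mul' g h := by
    ext n
    exact DFunLike.congr_fun (Algebra.TensorProduct.map_comp (R := k) (S := k) (g : L →ₐ[k] L)
      (h : L →ₐ[k] L) (AlgHom.id k H) (AlgHom.id k H)) n.1

/-- The action of `Gal(L/k)` on the group-like elements of `L ⊗ H`, by automorphisms. -/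
noncomputable def galoisMulAutGroupLike (hμ : IsModuleAlgebraAction μ)
    (hj : Function.Bijective (hopfGaloisMap μ)) (σ : K →ₐ[k] L) :
    (L ≃ₐ[k] L) →* MulAut (GroupLike L (L ⊗[k] H)) where
  toFun g := MonoidHom.toMulEquiv (galoisEndGroupLike hμ hj σ g) (galoisEndGroupLike hμ hj σ g⁻¹)
    (((galoisEndGroupLike hμ hj σ).map_mul _ _).symm.trans (by rw [inv_mul_cancel, map_one]; rfl))
    (((galoisEndGroupLike hμ hj σ).map_mul _ _).symm.trans (by rw [mul_inv_cancel, map_one]; rfl))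
  map_one' := MulEquiv.ext fun n =>
    DFunLike.congr_fun ((galoisEndGroupLike hμ hj σ).map_one) n
  map_mul' g h := MulEquiv.ext fun n =>
    DFunLike.congr_fun ((galoisEndGroupLike hμ hj σ).map_mul g h) n

theorem groupLikeEquivAlgHom_galois (hμ : IsModuleAlgebraAction μ)
    (hj : Function.Bijective (hopfGaloisMap μ)) (σ τ : K →ₐ[k] L) (g : L ≃ₐ[k] L)
    (n : GroupLike L (L ⊗[k] H)) :
    groupLikeEquivAlgHom hμ hj ((g : L →ₐ[k] L).comp τ) (galoisMulAutGroupLike hμ hj σ g n) =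
      (g : L →ₐ[k] L).comp (groupLikeEquivAlgHom hμ hj τ n) := by
  apply AlgHom.toLinearMap_injective
  rw [← twistedAction_groupLike]
  refine (twistedAction_comp μ τ (g : L →ₐ[k] L) n.1).trans ?_
  rw [twistedAction_groupLike hμ hj]
  rfl

/-- The map from `Gal(L/k)` to the holomorph of the group of group-like elements of `L ⊗ H`. -/
noncomputable def galoisHolomorph (hμ : IsModuleAlgebraAction μ)
    (hj : Function.Bijective (hopfGaloisMap μ)) (σ : K →ₐ[k] L) :
    (L ≃ₐ[k] L) →* GroupLike L (L ⊗[k] H) ⋊[MonoidHom.id (MulAut (GroupLike L (L ⊗[k] H)))]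
      MulAut (GroupLike L (L ⊗[k] H)) :=
  MonoidHom.mk'
    (fun g => ⟨(groupLikeEquivAlgHom hμ hj σ).symm ((g : L →ₐ[k] L).comp σ),
      galoisMulAutGroupLike hμ hj σ g⟩) fun g h => by
    -- Cocycle identity: with `σ·n_g = gσ`, one has `σ·(n_g g(n_h)) = (gσ)·g(n_h) = g(σ·n_h) = ghσ`.
    refine SemidirectProduct.ext ?_ (map_mul _ g h)
    rw [SemidirectProduct.mul_left, Equiv.symm_apply_eq, groupLikeEquivAlgHom_mul,
      Equiv.apply_symm_apply, MonoidHom.id_apply, groupLikeEquivAlgHom_galois,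
      Equiv.apply_symm_apply]
    rfl

/-- Every embedding is some `σ·n`, so the image of `g` determines `g ∘ τ` for all `τ`; the images of
the `τ` generate `L`. -/
theorem galoisHolomorph_injective [IsNormalClosure k K L] (hμ : IsModuleAlgebraAction μ)
    (hj : Function.Bijective (hopfGaloisMap μ)) (σ : K →ₐ[k] L) :
    Function.Injective (galoisHolomorph hμ hj σ) := by
  intro g h hgh
  have hσ : (g : L →ₐ[k] L).comp σ = (h : L →ₐ[k] L).comp σ :=
    (groupLikeEquivAlgHom hμ hj σ).symm.injective (congrArg SemidirectProduct.left hgh)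
  have hα : galoisMulAutGroupLike hμ hj σ g = galoisMulAutGroupLike hμ hj σ h :=
    congrArg SemidirectProduct.right hgh
  have hτ (τ : K →ₐ[k] L) : (g : L →ₐ[k] L).comp τ = (h : L →ₐ[k] L).comp τ := by
    obtain ⟨n, rfl⟩ := (groupLikeEquivAlgHom hμ hj σ).surjective τ
    rw [← groupLikeEquivAlgHom_galois hμ hj σ, ← groupLikeEquivAlgHom_galois hμ hj σ, hσ, hα]
  have htop : IntermediateField.normalClosure k K L ≤
      IntermediateField.fixedField (Subgroup.zpowers (h⁻¹ * g)) := by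
    rw [normalClosure_le_iff]
    rintro τ _ ⟨x, rfl⟩
    rw [IntermediateField.mem_fixedField_iff]
    have hx : h⁻¹ * g ∈ MulAction.stabilizer (L ≃ₐ[k] L) (τ x) := by
      rw [MulAction.mem_stabilizer_iff, mul_smul, inv_smul_eq_iff]
      exact DFunLike.congr_fun (hτ τ) x
    exact fun f hf => (Subgroup.zpowers_le.2 hx) hf
  rw [(Algebra.IsAlgebraic.isNormalClosure_iff.1 ‹_›).2] at htop
  ext x
  have hx := (IntermediateField.mem_fixedField_iff _ _).1 (htop (IntermediateField.mem_top (x := x)))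
    _ (Subgroup.mem_zpowers _)
  rw [AlgEquiv.mul_apply, AlgEquiv.aut_inv, AlgEquiv.symm_apply_eq] at hx
  exact hx

theorem natCard_groupLike [Algebra.IsSeparable k K] [IsNormalClosure k K L]
    (hμ : IsModuleAlgebraAction μ)
    (hj : Function.Bijective (hopfGaloisMap μ)) (σ : K →ₐ[k] L) :
    Nat.card (GroupLike L (L ⊗[k] H)) = Module.finrank k K := by
  rw [Nat.card_congr (groupLikeEquivAlgHom hμ hj σ),
    AlgHom.natCard_of_splits k K L IsNormalClosure.splits]

end Regular

/-! ### From Hopf Galois structures to the degree 6 obstruction. -/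

theorem IsHopfGalois.exists_injective_holomorph {k : Type u} {K : Type v} {L : Type w}
    [Field k] [Field K] [Field L] [Algebra k K] [Algebra k L] [FiniteDimensional k K]
    [Algebra.IsSeparable k K] [IsNormalClosure k K L] (σ : K →ₐ[k] L) (h : IsHopfGalois k K) :
    ∃ (N : Type (max u w)) (_ : Group N)
      (f : (L ≃ₐ[k] L) →* N ⋊[MonoidHom.id (MulAut N)] MulAut N),
      Nat.card N = Module.finrank k K ∧ Function.Injective f := by
  obtain ⟨H, _, _, μ, _, _, hμ, hj⟩ := h
  exact ⟨_, _, galoisHolomorph hμ hj σ, natCard_groupLike hμ hj σ,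
    galoisHolomorph_injective hμ hj σ⟩

theorem IsNormalClosure.isGalois (k K L : Type*) [Field k] [Field K] [Field L] [Algebra k K]
    [Algebra k L] [Algebra.IsSeparable k K] [IsNormalClosure k K L] : IsGalois k L := by
  have : Normal k L := IsNormalClosure.normal (K := K)
  have hle : IntermediateField.normalClosure k K L ≤ separableClosure k L := by
    rw [normalClosure_le_iff]
    rintro τ _ ⟨x, rfl⟩
    rw [mem_separableClosure_iff]
    exact IsSeparable.map τ τ.injective (Algebra.IsSeparable.isSeparable k x)
  rw [(Algebra.IsAlgebraic.isNormalClosure_iff.1 ‹_›).2] at hle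
  have : Algebra.IsSeparable k L := (separableClosure.eq_top_iff k L).1 (top_le_iff.1 hle)
  exact ⟨⟩

theorem mainTheorem6 {k : Type u} {K : Type v} {L : Type w} [Field k] [Field K] [Field L]
    [Algebra k K] [Algebra k L] [Algebra K L] [IsScalarTower k K L]
    [Algebra.IsSeparable k K] (hdeg : Module.finrank k K = 6) [IsNormalClosure k K L] :
    (Module.finrank k L = 24 ∨ 36 < Module.finrank k L → ¬ IsHopfGalois k K) ∧
    (Nonempty ((L ≃ₐ[k] L) ≃* alternatingGroup (Fin 4)) → ¬ IsHopfGalois k K) := by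
  have : FiniteDimensional k K := .of_finrank_pos (by omega)
  constructor
  · intro hL h
    obtain ⟨N, _, f, hN, hf⟩ := h.exists_injective_holomorph (IsScalarTower.toAlgHom k K L)
    -- Either alternative in `hL` excludes the default value 0 of `finrank`.
    have : FiniteDimensional k L := .of_finrank_pos (by omega)
    have : IsGalois k L := IsNormalClosure.isGalois k K L
    have hdvd := card_dvd_of_injective_holomorph (hN.trans hdeg) f hf
    rw [IsGalois.card_aut_eq_finrank] at hdvd
    have := Nat.le_of_dvd (by norm_num) hdvd
    rcases hL with hL | hL
    · rw [hL] at hdvd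
      omega
    · omega
  · rintro ⟨e⟩ h
    obtain ⟨N, _, f, hN, hf⟩ := h.exists_injective_holomorph (IsScalarTower.toAlgHom k K L)
    exact alternatingGroup_four_not_injective_holomorph (hN.trans hdeg)
      (f.comp e.symm.toMonoidHom) (hf.comp e.symm.injective)
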